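/- For positive integers $n,d$, let $A_2(n,d)$ be the maximum size of a set of binary words of length $n$ in which any two distinct words are at Hamming distance at least $d$, and for an integer $r\ge 0$ let $V(n,r)=\sum_{i=0}^{r}\binom{n}{i}$. For $x\in\mathbb{R}$ let $\lceil x\rceil^{+}$ be the smallest nonnegative integer $m$ with $m\ge x$, and for integers $0\le r\le n$ put $$ e(n,r)=\frac16\sum_{w=1}^{r}\binom{n}{w}\left(\left(\sum_{i=1}^{r}\ \sum_{j=\lceil (w+i-r)/2\rceil^{+}}^{\min\{w,i\}}\binom{w}{j}\binom{n-w}{i-j}\right)-1\right). $$ Let $n$ and $d$ be positive integers with $d\le n$. Let $\mathcal{G}_{\mathcal S}$ be the graph whose vertices are the words of $\mathbb{F}_2^n$ of Hamming weight between $1$ and $d-1$, two of them being adjacent if and only if their Hamming distance is between $1$ and $d-1$. Then $e(n,d-1)$ is one third of the number of edges of $\mathcal{G}_{\mathcal S}$, and $$ A_2(n,d)\ \ge\ \frac{2^n}{V(n,d-1)}\cdot\frac{\log_2 V(n,d-1)-\log_2\sqrt{e(n,d-1)}}{10}, $$ where for $d\in\{1,2\}$, the only cases in which $e(n,d-1)=0$,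 the undefined term $\log_2\sqrt{e(n,d-1)}$ is read as $0$. -/

import Mathlib

noncomputable section

/-- A set `C` of binary words of length `n` is a code of minimum distance (at least) `d`:
any two distinct codewords are at Hamming distance at least `d`. -/
def IsBinaryCode (n d : ℕ) (C : Finset (Fin n → ZMod 2)) : Prop :=
  ∀ u ∈ C, ∀ v ∈ C, u ≠ v → d ≤ hammingDist u v

/-- `A₂(n,d)`: the maximum size of a binary code of length `n` and minimum distance `d`.
The set of sizes is nonempty and bounded by `2 ^ n`, so the supremum is a maximum. -/
def A₂ (n d : ℕ) : ℕ :=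
  sSup {m : ℕ | ∃ C : Finset (Fin n → ZMod 2), IsBinaryCode n d C ∧ C.card = m}

/-- `V(n,r)`: the volume of a Hamming sphere of radius `r` in `𝔽₂ⁿ`. -/
def hammingVolume (n r : ℕ) : ℕ :=
  ∑ i ∈ Finset.range (r + 1), n.choose i

/-- The quantity `e(n,r)`. The lower limit `⌈x⌉₊` of the inner sum is the smallest nonnegative
integer `m` with `x ≤ m`. -/
def sphereEdgeThird (n r : ℕ) : ℝ :=
  (1 / 6 : ℝ) * ∑ w ∈ Finset.Icc 1 r, (n.choose w : ℝ) *
    ((∑ i ∈ Finset.Icc 1 r,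
        ∑ j ∈ Finset.Icc ⌈((w : ℝ) + (i : ℝ) - (r : ℝ)) / 2⌉₊ (min w i),
          (w.choose j : ℝ) * ((n - w).choose (i - j) : ℝ)) - 1)

/-- The Gilbert graph: vertex set `𝔽₂ⁿ`, with `u`, `v` adjacent iff `1 ≤ d(u,v) ≤ d - 1`. -/
def gilbertGraph (n d : ℕ) : SimpleGraph (Fin n → ZMod 2) where
  Adj u v := 1 ≤ hammingDist u v ∧ hammingDist u v ≤ d - 1
  symm := ⟨fun u v h => by rwa [hammingDist_comm v u]⟩
  loopless := ⟨fun u h => by simp at h⟩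

/-- The Hamming sphere graph: the subgraph of the Gilbert graph induced by the neighbourhood
of the zero word. -/
def sphereGraph (n d : ℕ) : SimpleGraph ((gilbertGraph n d).neighborSet 0) :=
  (gilbertGraph n d).induce ((gilbertGraph n d).neighborSet 0)

end

/-!
Sample an independent set `I` of a graph with maximum degree at most `D` from the hard-core model
at fugacity `l`, i.e. with probability proportional to `l ^ #I`. Condition on `I` outside the closed
neighbourhood of a vertex `v`, and let `T` be the set of neighbours of `v` that remain unblocked.
If `T` is small, then `v` itself is fairly likely to be chosen. If `T` is large, then `I` contains
many vertices of `T`, because `T` spans at most `s` edges and for `l` of order `1 / √s` these edges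
hardly interfere. Giving `v` the score `D` if `v ∈ I` and `#(I ∩ N(v))` otherwise, the mean score is
therefore of order at least `log (D / √s)` in both cases, while the scores of all vertices sum to at
most `2 * D * #I`. Averaging over `v` bounds the independence number from below; when the logarithm
is too small for this to help, a maximum independent set being dominating is enough.

Codes of minimum distance `d` are the independent sets of the Gilbert graph. Its translations make
all its neighbourhoods copies of the sphere graph, whose edges are counted by weight.
-/

open Finset Real

namespace HardCore

section DegreeSum

variable {V : Type*} {G : SimpleGraph V} [DecidableRel G.Adj] {S T : Finset V}

variable (G) in
/-- The sum of the degrees of `G[S]`, i.e. twice its number of edges. -/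
def degreeSum (S : Finset V) : ℕ :=
  ∑ u ∈ S, #{w ∈ S | G.Adj u w}

lemma degreeSum_mono (h : S ⊆ T) : degreeSum G S ≤ degreeSum G T :=
  (sum_le_sum fun _ _ => card_le_card (filter_subset_filter _ h)).trans
    (sum_le_sum_of_subset h)

lemma degreeSum_eq_two_mul_ncard_edgeSet (S : Finset V) :
    degreeSum G S = 2 * (G.induce S).edgeSet.ncard := by
  classical
  have hdeg (u : S) : #{w ∈ S | G.Adj u w} = (G.induce (S : Set V)).degree u := by
    rw [← SimpleGraph.card_neighborFinset_eq_degree,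
      ← card_map (Function.Embedding.subtype (· ∈ (S : Set V)))]
    congr 1
    ext w
    simp [and_comm]
  rw [degreeSum, ← sum_coe_sort, ← SimpleGraph.coe_edgeFinset, Set.ncard_coe_finset,
    ← SimpleGraph.sum_degrees_eq_twice_card_edges]
  exact sum_congr rfl fun u _ => hdeg u

end DegreeSum

section Configurations

variable {V : Type*} [DecidableEq V]

lemma isIndepSet_union {G : SimpleGraph V} {A B : Finset V} (h : Disjoint A B) :
    G.IsIndepSet (A ∪ B : Finset V) ↔
      G.IsIndepSet A ∧ G.IsIndepSet B ∧ ∀ a ∈ A, ∀ b ∈ B, ¬ G.Adj a b := by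
  rw [coe_union, SimpleGraph.IsIndepSet, Set.pairwise_union]
  refine and_congr_right fun _ => and_congr_right fun _ => ?_
  refine forall₂_congr fun a ha => forall₂_congr fun b hb => ?_
  have hab : a ≠ b := fun hab => disjoint_left.1 h ha (hab ▸ hb)
  simp [hab, G.adj_comm b a]

variable (G : SimpleGraph V) [DecidableRel G.Adj]

/-- The independent sets of `G` contained in `S`, i.e. the configurations of the hard-core model
on the induced graph `G[S]`. Working with `S` inside a fixed vertex type avoids subtypes. -/
def indepSets (S : Finset V) : Finset (Finset V) :=
  {A ∈ S.powerset | G.IsIndepSet A}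

/-- The partition function of the hard-core model on `G[S]` at fugacity `l`: each independent set
`A` has weight `l ^ #A`. -/
def partitionFn (l : ℝ) (S : Finset V) : ℝ :=
  ∑ A ∈ indepSets G S, l ^ #A

/-- The sum of the sizes of the independent sets of `G[S]` with their hard-core weights. Divided by
`partitionFn G l S` it is the mean size of a hard-core random set; it is left unnormalised so that
contributions of different sets `S` can be added. -/
def weightedSize (l : ℝ) (S : Finset V) : ℝ :=
  ∑ A ∈ indepSets G S, l ^ #A * #A

variable {G} {l : ℝ} {S T : Finset V}

lemma mem_indepSets {A : Finset V} : A ∈ indepSets G S ↔ A ⊆ S ∧ G.IsIndepSet A := by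
  rw [indepSets, mem_filter, mem_powerset]

lemma union_mem_indepSets {J A : Finset V} (h : Disjoint S T) (hJ : J ⊆ S) (hA : A ⊆ T) :
    J ∪ A ∈ indepSets G (S ∪ T) ↔
      J ∈ indepSets G S ∧ A ∈ indepSets G {u ∈ T | ∀ a ∈ J, ¬ G.Adj a u} := by
  have hsub : A ⊆ {u ∈ T | ∀ a ∈ J, ¬ G.Adj a u} ↔ ∀ a ∈ J, ∀ b ∈ A, ¬ G.Adj a b := by
    simp only [subset_iff, mem_filter]
    exact ⟨fun hadj a ha b hb => (hadj hb).2 a ha,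
      fun hadj b hb => ⟨hA hb, fun a ha => hadj a ha b hb⟩⟩
  rw [mem_indepSets, mem_indepSets, mem_indepSets, isIndepSet_union (h.mono hJ hA), hsub]
  have := union_subset_union hJ hA
  tauto

lemma sum_indepSets_union {M : Type*} [AddCommMonoid M] (h : Disjoint S T) (F : Finset V → M) :
    ∑ I ∈ indepSets G (S ∪ T), F I =
      ∑ J ∈ indepSets G S, ∑ A ∈ indepSets G {u ∈ T | ∀ a ∈ J, ¬ G.Adj a u}, F (J ∪ A) := by
  have hsplit {I : Finset V} (hI : I ∈ indepSets G (S ∪ T)) : I ∩ S ∪ I ∩ T = I := by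
    rw [← inter_union_distrib_left, inter_eq_left.2 (mem_indepSets.1 hI).1]
  have hsub {J A : Finset V} (hJA : (⟨J, A⟩ : (_ : Finset V) × Finset V) ∈
      (indepSets G S).sigma fun J => indepSets G {u ∈ T | ∀ a ∈ J, ¬ G.Adj a u}) :
      J ⊆ S ∧ A ⊆ T :=
    ⟨(mem_indepSets.1 (mem_sigma.1 hJA).1).1,
      (mem_indepSets.1 (mem_sigma.1 hJA).2).1.trans (filter_subset _ _)⟩
  rw [sum_sigma']
  refine sum_bij' (fun I _ => ⟨I ∩ S, I ∩ T⟩) (fun P _ => P.1 ∪ P.2) ?_ ?_ ?_ ?_ ?_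
  · intro I hI
    rw [← hsplit hI, union_mem_indepSets h inter_subset_right inter_subset_right] at hI
    exact mem_sigma.2 hI
  · intro P hP
    exact (union_mem_indepSets h (hsub hP).1 (hsub hP).2).2 (mem_sigma.1 hP)
  · exact fun I hI => hsplit hI
  · rintro ⟨J, A⟩ hP
    obtain ⟨hJ, hA⟩ := hsub hP
    have hJT := disjoint_iff_inter_eq_empty.1 (h.mono_left hJ)
    have hAS := disjoint_iff_inter_eq_empty.1 (h.mono_right hA).symm
    simp only [union_inter_distrib_right, inter_eq_left.2 hJ, inter_eq_left.2 hA, hJT, hAS,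
      union_empty, empty_union]
  · exact fun I hI => by rw [hsplit hI]

lemma sum_indepSets_insert {M : Type*} [AddCommMonoid M] {v : V} (hv : v ∉ S)
    (F : Finset V → M) :
    ∑ I ∈ indepSets G (insert v S), F I =
      ∑ A ∈ indepSets G S, F A + ∑ A ∈ indepSets G {u ∈ S | ¬ G.Adj v u}, F (insert v A) := by
  have hsingle : indepSets G {v} = {∅, {v}} := by
    rw [indepSets, filter_true_of_mem fun A hA => ?_]
    · rfl
    · rcases subset_singleton_iff.1 (mem_powerset.1 hA) with rfl | rfl <;> simp
  rw [insert_eq, sum_indepSets_union (disjoint_singleton_left.2 hv), hsingle,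
    sum_pair (singleton_ne_empty v).symm]
  simp only [notMem_empty, false_implies, implies_true, filter_true, empty_union, mem_singleton,
    forall_eq, insert_eq]

lemma sum_indepSets_filter_mem {u : V} (hu : u ∈ S) :
    ∑ A ∈ indepSets G S with u ∈ A, l ^ #A =
      l * partitionFn G l {w ∈ S.erase u | ¬ G.Adj u w} := by
  have hmem {A : Finset V} {P : V → Prop} [DecidablePred P]
      (hA : A ∈ indepSets G {w ∈ S.erase u | P w}) : u ∉ A :=
    fun h => notMem_erase u S (filter_subset _ _ ((mem_indepSets.1 hA).1 h))
  rw [sum_filter, ← insert_erase hu, sum_indepSets_insert (notMem_erase u S), insert_erase hu,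
    sum_eq_zero, zero_add, partitionFn, mul_sum]
  · refine sum_congr rfl fun A hA => ?_
    rw [if_pos (mem_insert_self u A), card_insert_of_notMem (hmem hA), pow_succ']
  · exact fun A hA => if_neg fun h => notMem_erase u S ((mem_indepSets.1 hA).1 h)

lemma weightedSize_eq_sum_partitionFn (l : ℝ) (S : Finset V) :
    weightedSize G l S = ∑ u ∈ S, l * partitionFn G l {w ∈ S.erase u | ¬ G.Adj u w} := by
  have hcard {A : Finset V} (hA : A ∈ indepSets G S) :
      l ^ #A * #A = ∑ u ∈ S, if u ∈ A then l ^ #A else 0 := by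
    rw [← sum_filter, filter_mem_eq_inter, inter_eq_right.2 (mem_indepSets.1 hA).1, sum_const,
      nsmul_eq_mul, mul_comm]
  rw [weightedSize, sum_congr rfl fun A hA => hcard hA, sum_comm]
  exact sum_congr rfl fun u hu => by rw [← sum_filter, sum_indepSets_filter_mem hu]

end Configurations

section Estimates

variable {V : Type*} [DecidableEq V] {G : SimpleGraph V} [DecidableRel G.Adj]
  {l : ℝ} {S T : Finset V}

lemma partitionFn_mono (hl : 0 ≤ l) (h : S ⊆ T) : partitionFn G l S ≤ partitionFn G l T :=
  sum_le_sum_of_subset_of_nonneg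
    (fun _ hA => mem_indepSets.2 ((mem_indepSets.1 hA).imp_left (·.trans h)))
    fun _ _ _ => by positivity

lemma one_le_partitionFn (hl : 0 ≤ l) (S : Finset V) : 1 ≤ partitionFn G l S := by
  have hempty : ∅ ∈ indepSets G S := mem_indepSets.2 (by simp)
  calc 1 = l ^ #(∅ : Finset V) := by rw [card_empty, pow_zero]
    _ ≤ partitionFn G l S :=
      single_le_sum (f := fun A => l ^ #A) (fun _ _ => by positivity) hempty

lemma partitionFn_union_le (hl : 0 ≤ l) (h : Disjoint S T) :
    partitionFn G l (S ∪ T) ≤ partitionFn G l S * partitionFn G l T := by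
  rw [partitionFn, sum_indepSets_union h, partitionFn, sum_mul]
  refine sum_le_sum fun J hJ => ?_
  have hcard {A : Finset V} (hA : A ∈ indepSets G {u ∈ T | ∀ a ∈ J, ¬ G.Adj a u}) :
      l ^ #(J ∪ A) = l ^ #J * l ^ #A := by
    rw [card_union_of_disjoint (h.mono (mem_indepSets.1 hJ).1
      ((mem_indepSets.1 hA).1.trans (filter_subset _ _))), pow_add]
  rw [sum_congr rfl fun A hA => hcard hA, ← mul_sum]
  exact mul_le_mul_of_nonneg_left (partitionFn_mono hl (filter_subset _ _)) (by positivity)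

lemma partitionFn_le_one_add_pow (hl : 0 ≤ l) (S : Finset V) :
    partitionFn G l S ≤ (1 + l) ^ #S :=
  calc partitionFn G l S ≤ ∑ A ∈ S.powerset, l ^ #A :=
        sum_le_sum_of_subset_of_nonneg (filter_subset _ _) fun _ _ _ => by positivity
    _ = (1 + l) ^ #S := by rw [add_comm, ← sum_pow_mul_eq_add_pow]; simp

lemma one_add_pow_le_exp_mul (hl : 0 ≤ l) (k : ℕ) : (1 + l) ^ k ≤ exp (l * k) := by
  rw [mul_comm, exp_nat_mul]
  exact pow_le_pow_left₀ (by linarith) (by linarith [add_one_le_exp l]) k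

lemma one_sub_mul_mul_one_add_pow_le_one (hl : 0 ≤ l) (k : ℕ) :
    (1 - l * k) * (1 + l) ^ k ≤ 1 :=
  calc (1 - l * k) * (1 + l) ^ k ≤ exp (-(l * k)) * exp (l * k) :=
        mul_le_mul (one_sub_le_exp_neg _) (one_add_pow_le_exp_mul hl k) (by positivity)
          (exp_pos _).le
    _ = 1 := by rw [← exp_add, neg_add_cancel, exp_zero]

lemma partitionFn_mul_one_sub_le (hl : 0 ≤ l) {u : V} (hu : u ∈ S) :
    partitionFn G l S * (1 - l * #{w ∈ S | G.Adj u w}) ≤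
      (1 + l) * partitionFn G l {w ∈ S.erase u | ¬ G.Adj u w} := by
  set N := {w ∈ S | G.Adj u w} with hN
  set T := {w ∈ S.erase u | ¬ G.Adj u w} with hT
  have hTpos : 0 < partitionFn G l T := one_pos.trans_le (one_le_partitionFn hl T)
  have hSpos : 0 < partitionFn G l S := one_pos.trans_le (one_le_partitionFn hl S)
  have huN : u ∉ N := by simp [hN]
  have hcover : S = insert u N ∪ T := by
    ext w
    by_cases hw : w = u <;> by_cases hadj : G.Adj u w <;> simp_all
  have hdisj : Disjoint (insert u N) T := by
    rw [disjoint_left]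
    intro w hw hwT
    simp only [hN, hT, mem_insert, mem_filter, mem_erase] at hw hwT
    tauto
  have hZ : partitionFn G l S ≤ (1 + l) ^ (#N + 1) * partitionFn G l T := by
    calc partitionFn G l S = partitionFn G l (insert u N ∪ T) := by rw [← hcover]
      _ ≤ partitionFn G l (insert u N) * partitionFn G l T := partitionFn_union_le hl hdisj
      _ ≤ (1 + l) ^ (#N + 1) * partitionFn G l T := by
        rw [← card_insert_of_notMem huN]
        exact mul_le_mul_of_nonneg_right (partitionFn_le_one_add_pow hl _) hTpos.le
  rcases le_or_gt (1 - l * #N) 0 with hneg | hpos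
  · exact (mul_nonpos_of_nonneg_of_nonpos hSpos.le hneg).trans (by positivity)
  · calc partitionFn G l S * (1 - l * #N)
        ≤ (1 + l) ^ (#N + 1) * partitionFn G l T * (1 - l * #N) :=
          mul_le_mul_of_nonneg_right hZ hpos.le
      _ = ((1 - l * #N) * (1 + l) ^ #N) * ((1 + l) * partitionFn G l T) := by ring
      _ ≤ (1 + l) * partitionFn G l T :=
          mul_le_of_le_one_left (by positivity) (one_sub_mul_mul_one_add_pow_le_one hl _)

lemma partitionFn_mul_le_weightedSize (hl : 0 ≤ l) (S : Finset V) :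
    partitionFn G l S * (l * (#S - l * degreeSum G S)) ≤ (1 + l) * weightedSize G l S := by
  calc partitionFn G l S * (l * (#S - l * degreeSum G S))
      = ∑ u ∈ S, l * (partitionFn G l S * (1 - l * #{w ∈ S | G.Adj u w})) := by
        rw [degreeSum, ← mul_sum, ← mul_sum, sum_sub_distrib, ← mul_sum]
        push_cast
        simp only [sum_const, nsmul_eq_mul, mul_one]
        ring
    _ ≤ ∑ u ∈ S, l * ((1 + l) * partitionFn G l {w ∈ S.erase u | ¬ G.Adj u w}) :=
        sum_le_sum fun u hu => mul_le_mul_of_nonneg_left (partitionFn_mul_one_sub_le hl hu) hl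
    _ = (1 + l) * weightedSize G l S := by
        rw [weightedSize_eq_sum_partitionFn, mul_sum]
        exact sum_congr rfl fun u _ => by ring

/-- A large `S` makes `weightedSize` large, a small one makes `partitionFn G l S` small, so that
`K` pays for the left side; `1 + log K - y ≤ K * exp (-y)` with `y = l * #S` balances the two. -/
lemma mul_add_partitionFn_le {K b c : ℝ} (hl : 0 ≤ l) (hK : 0 < K) (hb : 0 ≤ b)
    (hc : l ^ 2 * degreeSum G S ≤ c) (hbc : b * (1 + l) ^ 2 ≤ 1 + log K - c) :
    b * (l + partitionFn G l S) ≤ K + weightedSize G l S := by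
  set Z := partitionFn G l S
  set y := l * #S
  have hZ : 1 ≤ Z := one_le_partitionFn hl S
  have hZ_exp : Z ≤ exp y :=
    (partitionFn_le_one_add_pow hl S).trans (one_add_pow_le_exp_mul hl _)
  have hK_bound : Z * (1 + log K - y) ≤ K := by
    have hexp : 1 + log K - y ≤ K * exp (-y) := by
      have := add_one_le_exp (log K - y)
      rw [sub_eq_add_neg, exp_add, exp_log hK] at this
      linarith
    calc Z * (1 + log K - y) ≤ Z * (K * exp (-y)) :=
          mul_le_mul_of_nonneg_left hexp (by linarith)
      _ ≤ exp y * (K * exp (-y)) := mul_le_mul_of_nonneg_right hZ_exp (by positivity)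
      _ = K := by rw [mul_left_comm, ← exp_add, add_neg_cancel, exp_zero, mul_one]
  have hsize_bound : Z * (y - c) ≤ (1 + l) * weightedSize G l S := by
    refine le_trans (mul_le_mul_of_nonneg_left ?_ (by linarith))
      (partitionFn_mul_le_weightedSize hl S)
    linarith
  refine le_of_mul_le_mul_left (a := 1 + l) ?_ (by linarith)
  calc (1 + l) * (b * (l + Z)) ≤ (1 + l) * (b * ((1 + l) * Z)) := by
        gcongr
        linarith [le_mul_of_one_le_right hl hZ]
    _ = Z * (b * (1 + l) ^ 2) := by ring
    _ ≤ Z * (1 + log K - c) := mul_le_mul_of_nonneg_left hbc (by linarith)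
    _ = Z * (1 + log K - y) + Z * (y - c) := by ring
    _ ≤ K + (1 + l) * weightedSize G l S := add_le_add hK_bound hsize_bound
    _ ≤ (1 + l) * (K + weightedSize G l S) := by linarith [mul_nonneg hl hK.le]

end Estimates

section Averaging

variable {V : Type*} [Fintype V] [DecidableEq V] {G : SimpleGraph V} [DecidableRel G.Adj]
  {l b c : ℝ} {D : ℕ}

/-- Reveal the configuration outside the closed neighbourhood of `v` first: given its part `J`
there, either `v` is added or the rest is a configuration on the unblocked neighbours of `v`. -/
lemma sum_indepSets_univ (l : ℝ) (v : V) (f : Finset V → ℝ) :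
    ∑ I ∈ indepSets G univ, l ^ #I * f (I ∩ insert v (G.neighborFinset v)) =
      ∑ J ∈ indepSets G {u ∈ univ.erase v | ¬ G.Adj v u}, l ^ #J * (l * f {v} +
        ∑ A ∈ indepSets G {u ∈ G.neighborFinset v | ∀ a ∈ J, ¬ G.Adj a u}, l ^ #A * f A) := by
  set N := G.neighborFinset v with hN
  set P := {u ∈ univ.erase v | ¬ G.Adj v u} with hP
  have hcover : univ.erase v = P ∪ N := by
    ext u
    by_cases hu : u = v <;> by_cases hadj : G.Adj v u <;> simp_all
  have hPN : Disjoint P N := by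
    rw [disjoint_left]
    intro u hu huN
    exact (mem_filter.1 hu).2 ((G.mem_neighborFinset v u).1 huN)
  have hvP : v ∉ P := by simp [hP]
  rw [← insert_erase (mem_univ v), sum_indepSets_insert (notMem_erase v univ), ← hP, hcover,
    sum_indepSets_union hPN, ← sum_add_distrib]
  refine sum_congr rfl fun J hJ => ?_
  have hJP : J ⊆ P := (mem_indepSets.1 hJ).1
  have hvJ : v ∉ J := fun h => hvP (hJP h)
  have hJN : J ∩ insert v N = ∅ :=
    disjoint_iff_inter_eq_empty.1 (disjoint_insert_right.2 ⟨hvJ, hPN.mono_left hJP⟩)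
  have hv : insert v J ∩ insert v N = {v} := by
    rw [insert_inter_of_mem (mem_insert_self v N), hJN, insert_empty]
  rw [hv, card_insert_of_notMem hvJ, mul_add, mul_sum, add_comm, pow_succ, mul_assoc]
  congr 1
  refine sum_congr (by congr!) fun A hA => ?_
  have hAN : A ⊆ N := (mem_indepSets.1 hA).1.trans (filter_subset _ _)
  rw [union_inter_distrib_right, hJN, empty_union,
    inter_eq_left.2 (hAN.trans (subset_insert v N)), card_union_of_disjoint (hPN.mono hJP hAN),
    pow_add, mul_assoc]

/-- What `v` collects from a configuration `I`: `D` if `v ∈ I`, and one for each neighbour of `v`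
in `I` otherwise. -/
def localScore (G : SimpleGraph V) [DecidableRel G.Adj] (D : ℕ) (v : V) (I : Finset V) : ℕ :=
  if v ∈ I then D else #(I ∩ G.neighborFinset v)

lemma mul_partitionFn_univ_le (hl : 0 < l) (hD : 0 < D) (v : V)
    (hc : l ^ 2 * degreeSum G (G.neighborFinset v) ≤ c) (hb : 0 ≤ b)
    (hbc : b * (1 + l) ^ 2 ≤ 1 + log (l * D) - c) :
    b * partitionFn G l univ ≤ ∑ I ∈ indepSets G univ, l ^ #I * localScore G D v I := by
  set f : Finset V → ℝ := fun B => if v ∈ B then D else #B with hf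
  have hscore (I : Finset V) :
      (localScore G D v I : ℝ) = f (I ∩ insert v (G.neighborFinset v)) := by
    by_cases hv : v ∈ I
    · simp [localScore, hf, hv]
    · simp [localScore, hf, hv, inter_insert_of_notMem]
  have hlocal {T : Finset V} (hT : T ⊆ G.neighborFinset v) :
      b * (l + partitionFn G l T) ≤ l * f {v} + ∑ A ∈ indepSets G T, l ^ #A * f A := by
    have hvT : v ∉ T := fun h => by simpa using hT h
    have hfA {A : Finset V} (hA : A ∈ indepSets G T) : f A = #A :=
      if_neg fun h => hvT ((mem_indepSets.1 hA).1 h)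
    rw [sum_congr rfl fun A hA => by rw [hfA hA], show f {v} = D by simp [hf]]
    refine mul_add_partitionFn_le hl.le (by positivity) hb (le_trans ?_ hc) hbc
    gcongr
    exact degreeSum_mono hT
  calc b * partitionFn G l univ
      = ∑ J ∈ indepSets G {u ∈ univ.erase v | ¬ G.Adj v u}, l ^ #J * (b * (l +
          partitionFn G l {u ∈ G.neighborFinset v | ∀ a ∈ J, ¬ G.Adj a u})) := by
        have hsplit := sum_indepSets_univ (G := G) l v fun _ => 1
        simp only [mul_one] at hsplit
        rw [partitionFn, hsplit, mul_sum]
        exact sum_congr rfl fun J _ => mul_left_comm _ _ _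
    _ ≤ ∑ I ∈ indepSets G univ, l ^ #I * localScore G D v I := by
        simp only [hscore]
        rw [sum_indepSets_univ]
        gcongr
        exact hlocal (filter_subset _ _)

lemma sum_localScore_le (hdeg : ∀ v, G.degree v ≤ D) (I : Finset V) :
    ∑ v, localScore G D v I ≤ 2 * D * #I := by
  have hcount : ∑ v, #(I ∩ G.neighborFinset v) ≤ D * #I := by
    calc ∑ v, #(I ∩ G.neighborFinset v) = ∑ v, #{u ∈ I | G.Adj v u} := by
          refine sum_congr rfl fun v _ => congrArg card ?_
          ext u
          simp
      _ = ∑ u ∈ I, G.degree u := by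
          refine (sum_card_bipartiteAbove_eq_sum_card_bipartiteBelow G.Adj).trans ?_
          refine sum_congr rfl fun u _ => congrArg card ?_
          ext v
          simp [G.adj_comm u v]
      _ ≤ D * #I := by
          rw [mul_comm, ← smul_eq_mul]
          exact sum_le_card_nsmul _ _ _ fun u _ => hdeg u
  calc ∑ v, localScore G D v I ≤ ∑ v, ((if v ∈ I then D else 0) + #(I ∩ G.neighborFinset v)) := by
        refine sum_le_sum fun v _ => ?_
        rw [localScore]
        split_ifs <;> omega
    _ ≤ D * #I + D * #I := by
        rw [sum_add_distrib, sum_ite_mem, univ_inter, sum_const, smul_eq_mul, mul_comm]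
        gcongr
    _ = 2 * D * #I := by ring

end Averaging

section IndependenceNumber

variable {V : Type*} [Fintype V] {G : SimpleGraph V} [DecidableRel G.Adj] {l b c s : ℝ} {D : ℕ}

lemma card_mul_le_indepNum (hl : 0 < l) (hD : 0 < D) (hdeg : ∀ v, G.degree v ≤ D)
    (hc : ∀ v, l ^ 2 * degreeSum G (G.neighborFinset v) ≤ c) (hb : 0 ≤ b)
    (hbc : b * (1 + l) ^ 2 ≤ 1 + log (l * D) - c) :
    Fintype.card V * b ≤ 2 * D * G.indepNum := by
  classical
  have hZ : 0 < partitionFn G l univ := one_pos.trans_le (one_le_partitionFn hl.le univ)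
  refine le_of_mul_le_mul_right ?_ hZ
  calc Fintype.card V * b * partitionFn G l univ
      = ∑ _v : V, b * partitionFn G l univ := by
        rw [sum_const, card_univ, nsmul_eq_mul, mul_assoc]
    _ ≤ ∑ v, ∑ I ∈ indepSets G univ, l ^ #I * localScore G D v I :=
        sum_le_sum fun v _ => mul_partitionFn_univ_le hl hD v (hc v) hb hbc
    _ = ∑ I ∈ indepSets G univ, l ^ #I * (∑ v, localScore G D v I : ℕ) := by
        rw [sum_comm]
        push_cast
        simp only [mul_sum]
    _ ≤ ∑ I ∈ indepSets G univ, l ^ #I * (2 * D * G.indepNum : ℕ) := by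
        gcongr with I hI
        exact (sum_localScore_le hdeg I).trans
          (Nat.mul_le_mul_left _ (mem_indepSets.1 hI).2.card_le_indepNum)
    _ = 2 * D * G.indepNum * partitionFn G l univ := by
        rw [← sum_mul, mul_comm, partitionFn]
        push_cast
        rfl

lemma card_le_add_one_mul_indepNum (hdeg : ∀ v, G.degree v ≤ D) :
    Fintype.card V ≤ (D + 1) * G.indepNum := by
  classical
  obtain ⟨I, hI⟩ := G.exists_isNIndepSet_indepNum
  have hdom : univ ⊆ I.biUnion fun u => insert u (G.neighborFinset u) := by
    intro v _
    simp only [mem_biUnion, mem_insert, SimpleGraph.mem_neighborFinset]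
    by_contra! hv
    have hvI : v ∉ I := fun h => (hv v h).1 rfl
    have hins : G.IsIndepSet (insert v I : Finset V) := by
      rw [insert_eq, isIndepSet_union (disjoint_singleton_left.2 hvI)]
      refine ⟨by simp, hI.isIndepSet, fun a ha u hu hadj => (hv u hu).2 ?_⟩
      rw [← mem_singleton.1 ha]
      exact hadj.symm
    have := hins.card_le_indepNum
    rw [card_insert_of_notMem hvI, hI.card_eq] at this
    omega
  calc Fintype.card V ≤ #(I.biUnion fun u => insert u (G.neighborFinset u)) :=
        card_univ (α := V) ▸ card_le_card hdom
    _ ≤ #I * (D + 1) := card_biUnion_le_card_mul _ _ _ fun u _ =>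
        (card_insert_le _ _).trans (Nat.succ_le_succ (hdeg u))
    _ = (D + 1) * G.indepNum := by rw [hI.card_eq, mul_comm]

lemma card_mul_log_le_indepNum (hD : 0 < D) (hdeg : ∀ v, G.degree v ≤ D) (hs : 1 ≤ s)
    (hedge : ∀ v, ((G.induce (G.neighborSet v)).edgeSet.ncard : ℝ) ≤ s) :
    Fintype.card V * (1 + 2 * log (D / (2 * √s))) ≤ 9 * D * G.indepNum := by
  have hsqrt : 1 ≤ √s := one_le_sqrt.2 hs
  rcases le_or_gt (1 + 2 * log (D / (2 * √s))) 0 with hneg | hpos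
  · exact (mul_nonpos_of_nonneg_of_nonpos (by positivity) hneg).trans (by positivity)
  set l := 1 / (2 * √s) with hl
  have hl_le : l ≤ 1 / 2 := one_div_le_one_div_of_le two_pos (by linarith)
  have hl_sq : l ^ 2 * (2 * s) = 1 / 2 := by
    rw [hl, div_pow, mul_pow, sq_sqrt (by linarith)]
    field_simp
  have hc (v : V) : l ^ 2 * degreeSum G (G.neighborFinset v) ≤ 1 / 2 := by
    rw [← hl_sq, degreeSum_eq_two_mul_ncard_edgeSet, G.coe_neighborFinset]
    push_cast
    gcongr
    exact hedge v
  set b := 4 / 9 * (1 / 2 + log (D / (2 * √s))) with hb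
  have hb_nonneg : 0 ≤ b := by rw [hb]; linarith
  have hbc : b * (1 + l) ^ 2 ≤ 1 + log (l * D) - 1 / 2 := by
    have hl_add : (1 + l) ^ 2 ≤ (1 + 1 / 2) ^ 2 := by gcongr
    calc b * (1 + l) ^ 2 ≤ b * (1 + 1 / 2) ^ 2 := by gcongr
      _ = 1 + log (l * D) - 1 / 2 := by rw [hb, hl, one_div_mul_eq_div]; ring
  have := card_mul_le_indepNum (by positivity) hD hdeg hc hb_nonneg hbc
  rw [hb] at this
  linarith

lemma logb_sub_logb_le_log {x : ℝ} (hx : 1 ≤ x) (hs : 0 < s)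
    (h : 10 ≤ logb 2 (x + 1) - logb 2 √(s / 3)) :
    9 / 10 * (logb 2 (x + 1) - logb 2 √(s / 3)) ≤ 1 + 2 * log (x / (2 * √s)) := by
  have hlog_two := log_two_gt_d9
  have hlogb : (logb 2 (x + 1) - logb 2 √(s / 3)) * log 2 = log (x + 1) - log √s + log 3 / 2 := by
    rw [← logb_div (by positivity) (by positivity), logb, div_mul_cancel₀ _ (by positivity),
      log_div (by positivity) (by positivity), log_sqrt (by positivity),
      log_div hs.ne' three_ne_zero, log_sqrt hs.le]
    ring
  have hlog_three : log 3 ≤ 2 * log 2 := by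
    rw [← log_rpow two_pos]
    exact log_le_log three_pos (by norm_num)
  have hlog_add_one : log (x + 1) ≤ log 2 + log x := by
    rw [← log_mul two_ne_zero (by positivity)]
    exact log_le_log (by positivity) (by linarith)
  rw [log_div (by positivity) (by positivity), log_mul two_ne_zero (by positivity)]
  nlinarith

theorem card_div_mul_logb_le_indepNum (hdeg : ∀ v, G.degree v ≤ D) (hs : 1 ≤ s)
    (hedge : ∀ v, ((G.induce (G.neighborSet v)).edgeSet.ncard : ℝ) ≤ s) :
    Fintype.card V / (D + 1 : ℝ) * ((logb 2 (D + 1) - logb 2 √(s / 3)) / 10) ≤ G.indepNum := by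
  set L := logb 2 (D + 1) - logb 2 √(s / 3) with hL
  rw [div_mul_eq_mul_div, div_le_iff₀ (by positivity)]
  rcases le_or_gt L 10 with hL_le | hL_gt
  · have hgreedy : (Fintype.card V : ℝ) ≤ (D + 1) * G.indepNum := by
      exact_mod_cast card_le_add_one_mul_indepNum hdeg
    calc Fintype.card V * (L / 10) ≤ Fintype.card V :=
          mul_le_of_le_one_right (by positivity) (by linarith)
      _ ≤ G.indepNum * (D + 1) := by rwa [mul_comm]
  · have hD : 0 < D := by
      refine Nat.pos_of_ne_zero fun hD => hL_gt.not_ge ?_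
      have hlogb : logb 2 2⁻¹ ≤ logb 2 √(s / 3) :=
        logb_le_logb_of_le one_lt_two (by norm_num) (le_sqrt_of_sq_le (by linarith))
      rw [logb_inv, logb_self_eq_one one_lt_two] at hlogb
      rw [hL, hD, Nat.cast_zero, zero_add, logb_one]
      linarith
    have hlog := logb_sub_logb_le_log (mod_cast hD : (1 : ℝ) ≤ D) (by linarith) hL_gt.le
    calc Fintype.card V * (L / 10)
        ≤ Fintype.card V * (1 + 2 * log (D / (2 * √s))) / 9 := by
          rw [mul_div_assoc]
          exact mul_le_mul_of_nonneg_left (by linarith) (by positivity)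
      _ ≤ G.indepNum * D := by
          have := card_mul_log_le_indepNum hD hdeg hs hedge
          linarith
      _ ≤ G.indepNum * (D + 1) := by gcongr; linarith

end IndependenceNumber

end HardCore

namespace BinaryWord

section FinsetCount

variable {α : Type*} [Fintype α] [DecidableEq α]

lemma card_filter_card_inter_card_sdiff (S : Finset α) (j k : ℕ) :
    #{T : Finset α | #(T ∩ S) = j ∧ #(T \ S) = k} =
      (#S).choose j * (Fintype.card α - #S).choose k := by
  have hsplit {A B : Finset α} (hA : A ⊆ S) (hB : B ⊆ Sᶜ) :
      (A ∪ B) ∩ S = A ∧ (A ∪ B) \ S = B := by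
    have hBS : Disjoint B S := disjoint_left.2 fun x hx => mem_compl.1 (hB hx)
    rw [union_inter_distrib_right, inter_eq_left.2 hA, disjoint_iff_inter_eq_empty.1 hBS,
      union_sdiff_distrib, sdiff_eq_empty_iff_subset.2 hA, sdiff_eq_self_of_disjoint hBS]
    exact ⟨union_empty A, empty_union B⟩
  rw [← card_compl, ← card_powersetCard, ← card_powersetCard, ← card_product]
  refine card_bij' (fun T _ => (T ∩ S, T \ S)) (fun P _ => P.1 ∪ P.2) ?_ ?_ ?_ ?_
  · intro T hT
    rw [mem_filter_univ] at hT
    rw [mem_product, mem_powersetCard, mem_powersetCard, sdiff_eq_inter_compl]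
    exact ⟨⟨inter_subset_right, hT.1⟩, inter_subset_right, sdiff_eq_inter_compl T S ▸ hT.2⟩
  · intro P hP
    rw [mem_product, mem_powersetCard, mem_powersetCard] at hP
    obtain ⟨hinter, hsdiff⟩ := hsplit hP.1.1 hP.2.1
    rw [mem_filter_univ, hinter, hsdiff]
    exact ⟨hP.1.2, hP.2.2⟩
  · exact fun T _ => by rw [union_comm, sdiff_union_inter]
  · intro P hP
    rw [mem_product, mem_powersetCard, mem_powersetCard] at hP
    exact Prod.ext_iff.2 (hsplit hP.1.1 hP.2.1)

lemma card_filter_card_add_card_le (S : Finset α) (r : ℕ) :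
    #{T : Finset α | #T ∈ Icc 1 r ∧ #S + #T ≤ r + 2 * #(T ∩ S)} =
      ∑ i ∈ Icc 1 r, ∑ j ∈ Icc ⌈((#S : ℝ) + (i : ℝ) - (r : ℝ)) / 2⌉₊ (min #S i),
        (#S).choose j * (Fintype.card α - #S).choose (i - j) := by
  have hceil (i j : ℕ) : ⌈((#S : ℝ) + (i : ℝ) - (r : ℝ)) / 2⌉₊ ≤ j ↔ #S + i ≤ r + 2 * j := by
    rw [Nat.ceil_le, div_le_iff₀ two_pos, sub_le_iff_le_add, mul_comm, add_comm (_ * _)]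
    exact_mod_cast Iff.rfl
  have hcard (T : Finset α) : #(T ∩ S) + #(T \ S) = #T := card_inter_add_card_sdiff T S
  rw [card_eq_sum_card_fiberwise (f := card) (t := Icc 1 r)
    fun T hT => ((mem_filter_univ T).1 hT).1]
  refine sum_congr rfl fun i hi => ?_
  rw [card_eq_sum_card_fiberwise (f := fun T => #(T ∩ S))
    (t := Icc ⌈((#S : ℝ) + (i : ℝ) - (r : ℝ)) / 2⌉₊ (min #S i))]
  · refine sum_congr rfl fun j hj => ?_
    rw [mem_Icc, hceil, le_min_iff] at hj
    rw [← card_filter_card_inter_card_sdiff]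
    congr 1
    ext T
    have := hcard T
    simp only [mem_filter, mem_univ, true_and, mem_Icc] at hi ⊢
    omega
  · intro T hT
    rw [mem_coe, mem_filter, mem_filter_univ] at hT
    obtain ⟨⟨_, hle⟩, rfl⟩ := hT
    exact mem_Icc.2 ⟨(hceil _ _).2 hle, le_min (card_le_card inter_subset_right)
      (card_le_card inter_subset_left)⟩

end FinsetCount

section Words

variable {ι : Type*} [Fintype ι] [DecidableEq ι]

/-- The support of a binary word, as a bijection onto the finite sets of coordinates. It turns
counts of words by weight and distance into counts of sets. -/
def support : (ι → ZMod 2) ≃ Finset ι where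
  toFun u := {i | u i ≠ 0}
  invFun S i := if i ∈ S then 1 else 0
  left_inv u := by
    have hbit : ∀ a : ZMod 2, (if a ≠ 0 then (1 : ZMod 2) else 0) = a := by decide
    funext i
    simpa using hbit (u i)
  right_inv S := by
    ext i
    simp

lemma card_support (u : ι → ZMod 2) : #(support u) = hammingNorm u := rfl

lemma hammingDist_add_two_mul_card_inter (u v : ι → ZMod 2) :
    hammingDist u v + 2 * #(support v ∩ support u) = hammingNorm u + hammingNorm v := by
  have hdist : hammingDist u v = #(support u \ support v ∪ support v \ support u) := by
    have hbit : ∀ a b : ZMod 2, a ≠ b ↔ (a ≠ 0 ∧ ¬ b ≠ 0) ∨ (b ≠ 0 ∧ ¬ a ≠ 0) := by decide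
    rw [hammingDist]
    congr 1
    ext i
    simpa [support] using hbit (u i) (v i)
  rw [hdist, card_union_of_disjoint disjoint_sdiff_sdiff, ← card_support, ← card_support,
    ← card_inter_add_card_sdiff (support u) (support v),
    ← card_inter_add_card_sdiff (support v) (support u), inter_comm (support u)]
  ring

lemma card_filter_hammingNorm_eq (w : ℕ) :
    #{u : ι → ZMod 2 | hammingNorm u = w} = (Fintype.card ι).choose w := by
  rw [← card_univ, ← card_powersetCard]
  exact card_bijective _ support.bijective fun u => by simp [mem_powersetCard, card_support]

lemma card_filter_hammingNorm_le (r : ℕ) :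
    #{u : ι → ZMod 2 | hammingNorm u ≤ r} = hammingVolume (Fintype.card ι) r := by
  rw [hammingVolume, card_eq_sum_card_fiberwise (f := hammingNorm) (t := range (r + 1))]
  · refine sum_congr rfl fun i hi => ?_
    rw [← card_filter_hammingNorm_eq, filter_filter]
    congr 1
    ext u
    simp only [mem_filter, mem_univ, true_and, mem_range] at hi ⊢
    omega
  · intro u hu
    simpa [Nat.lt_succ_iff] using hu

lemma card_filter_hammingNorm_hammingDist_le (u : ι → ZMod 2) (r : ℕ) :
    #{v : ι → ZMod 2 | hammingNorm v ∈ Icc 1 r ∧ hammingDist u v ≤ r} =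
      ∑ i ∈ Icc 1 r, ∑ j ∈ Icc ⌈((hammingNorm u : ℝ) + (i : ℝ) - (r : ℝ)) / 2⌉₊
        (min (hammingNorm u) i),
        (hammingNorm u).choose j * (Fintype.card ι - hammingNorm u).choose (i - j) := by
  rw [← card_support u, ← card_filter_card_add_card_le]
  refine card_bijective _ support.bijective fun v => ?_
  have := hammingDist_add_two_mul_card_inter u v
  rw [mem_filter_univ, mem_filter_univ, card_support, card_support]
  exact and_congr_right fun _ => by omega

end Words

end BinaryWord

namespace gilbertGraph

variable {n d : ℕ}

instance : DecidableRel (gilbertGraph n d).Adj := fun u v =>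
  inferInstanceAs (Decidable (1 ≤ hammingDist u v ∧ hammingDist u v ≤ d - 1))

lemma adj_iff {u v : Fin n → ZMod 2} :
    (gilbertGraph n d).Adj u v ↔ u ≠ v ∧ hammingDist u v ≤ d - 1 := by
  rw [← hammingDist_pos]
  rfl

lemma mem_neighborFinset_zero {v : Fin n → ZMod 2} :
    v ∈ (gilbertGraph n d).neighborFinset 0 ↔ hammingNorm v ∈ Icc 1 (d - 1) := by
  rw [SimpleGraph.mem_neighborFinset, mem_Icc, ← hammingDist_zero_left]
  rfl

/-- Translation by a word, as an automorphism of the Gilbert graph; it moves the neighbourhood of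
`0` to that of any other word. -/
def addLeftIso (d : ℕ) (a : Fin n → ZMod 2) : gilbertGraph n d ≃g gilbertGraph n d where
  toEquiv := Equiv.addLeft a
  map_rel_iff' := by simp [adj_iff, hammingDist]

lemma addLeftIso_zero (a : Fin n → ZMod 2) : addLeftIso d a 0 = a := add_zero a

lemma degree_add_one (a : Fin n → ZMod 2) :
    (gilbertGraph n d).degree a + 1 = hammingVolume n (d - 1) := by
  have hdeg : (gilbertGraph n d).degree a = (gilbertGraph n d).degree 0 := by
    convert (addLeftIso d a).degree_eq 0
    exact (addLeftIso_zero a).symm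
  have h_zero : (0 : Fin n → ZMod 2) ∉ (gilbertGraph n d).neighborFinset 0 := by simp
  have hball := BinaryWord.card_filter_hammingNorm_le (ι := Fin n) (d - 1)
  rw [Fintype.card_fin] at hball
  rw [hdeg, ← SimpleGraph.card_neighborFinset_eq_degree, ← card_insert_of_notMem h_zero, ← hball]
  congr 1
  ext v
  rw [mem_insert, mem_neighborFinset_zero, mem_filter_univ, mem_Icc, ← hammingNorm_eq_zero]
  omega

lemma ncard_edgeSet_induce_neighborSet (a : Fin n → ZMod 2) :
    ((gilbertGraph n d).induce ((gilbertGraph n d).neighborSet a)).edgeSet.ncard =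
      (sphereGraph n d).edgeSet.ncard := by
  have hbij : Set.BijOn (addLeftIso d a) ((gilbertGraph n d).neighborSet 0)
      ((gilbertGraph n d).neighborSet a) := by
    refine (addLeftIso d a).toEquiv.bijOn fun v => ?_
    have := (addLeftIso d a).map_adj_iff (v := 0) (w := v)
    rwa [addLeftIso_zero] at this
  exact (Nat.card_congr ((addLeftIso d a).induce hbij).mapEdgeSet).symm

lemma card_filter_adj_neighborFinset_zero {u : Fin n → ZMod 2}
    (hu : u ∈ (gilbertGraph n d).neighborFinset 0) :
    #{v ∈ (gilbertGraph n d).neighborFinset 0 | (gilbertGraph n d).Adj u v} + 1 =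
      #{v : Fin n → ZMod 2 | hammingNorm v ∈ Icc 1 (d - 1) ∧ hammingDist u v ≤ d - 1} := by
  rw [← card_insert_of_notMem (a := u) (by simp)]
  congr 1
  ext v
  rw [mem_insert, mem_filter, mem_filter_univ, ← mem_neighborFinset_zero, adj_iff]
  rcases eq_or_ne v u with rfl | hvu
  · simp [hu]
  · simp [hvu, hvu.symm]

lemma degreeSum_neighborFinset_zero :
    (HardCore.degreeSum (gilbertGraph n d) ((gilbertGraph n d).neighborFinset 0) : ℝ) =
      6 * sphereEdgeThird n (d - 1) := by
  set N := (gilbertGraph n d).neighborFinset 0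
  set f : ℕ → ℝ := fun w => (∑ i ∈ Icc 1 (d - 1),
    ∑ j ∈ Icc ⌈((w : ℝ) + (i : ℝ) - ((d - 1 : ℕ) : ℝ)) / 2⌉₊ (min w i),
      (w.choose j : ℝ) * ((n - w).choose (i - j) : ℝ)) - 1 with hf
  have hdeg {u : Fin n → ZMod 2} (hu : u ∈ N) :
      (#{v ∈ N | (gilbertGraph n d).Adj u v} : ℝ) = f (hammingNorm u) := by
    have hcount := (card_filter_adj_neighborFinset_zero hu).trans
      (BinaryWord.card_filter_hammingNorm_hammingDist_le u (d - 1))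
    rw [Fintype.card_fin] at hcount
    rw [hf, eq_sub_iff_add_eq]
    exact_mod_cast hcount
  have hweight {w : ℕ} (hw : w ∈ Icc 1 (d - 1)) :
      #{u ∈ N | hammingNorm u = w} = n.choose w := by
    have hcard := BinaryWord.card_filter_hammingNorm_eq (ι := Fin n) w
    rw [Fintype.card_fin] at hcard
    rw [← hcard]
    congr 1
    ext u
    rw [mem_filter, mem_filter_univ, mem_neighborFinset_zero]
    exact and_iff_right_of_imp fun h => h ▸ hw
  calc (HardCore.degreeSum (gilbertGraph n d) N : ℝ) = ∑ u ∈ N, f (hammingNorm u) := by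
        rw [HardCore.degreeSum, Nat.cast_sum]
        exact sum_congr rfl fun u hu => hdeg hu
    _ = ∑ w ∈ Icc 1 (d - 1), n.choose w * f w := by
        rw [← sum_fiberwise_of_maps_to fun u hu => mem_neighborFinset_zero.1 hu]
        refine sum_congr rfl fun w hw => ?_
        rw [← hweight hw, ← nsmul_eq_mul, ← sum_const]
        exact sum_congr rfl fun u hu => by rw [(mem_filter.1 hu).2]
    _ = 6 * sphereEdgeThird n (d - 1) := by
        rw [sphereEdgeThird, ← mul_assoc, mul_one_div_cancel (by norm_num), one_mul]

lemma sphereEdgeThird_eq_ncard_edgeSet_div_three :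
    sphereEdgeThird n (d - 1) = (sphereGraph n d).edgeSet.ncard / 3 := by
  have h := degreeSum_neighborFinset_zero (n := n) (d := d)
  rw [HardCore.degreeSum_eq_two_mul_ncard_edgeSet, SimpleGraph.coe_neighborFinset] at h
  rw [sphereGraph]
  push_cast at h
  linarith

lemma isNIndepSet_iff {m : ℕ} {C : Finset (Fin n → ZMod 2)} :
    (gilbertGraph n d).IsNIndepSet m C ↔ IsBinaryCode n d C ∧ #C = m := by
  rw [SimpleGraph.isNIndepSet_iff]
  refine and_congr_left fun _ => forall₂_congr fun u _ => forall₂_congr fun v _ => ?_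
  refine forall_congr' fun huv => ?_
  have := hammingDist_pos.2 huv
  simp only [adj_iff, huv, ne_eq, not_false_eq_true, true_and]
  omega

lemma indepNum_eq_A₂ : (gilbertGraph n d).indepNum = A₂ n d := by
  simp only [SimpleGraph.indepNum, A₂, isNIndepSet_iff]

end gilbertGraph

theorem mainTheorem2 (n d : ℕ) (hd : 1 ≤ d) (hdn : d ≤ n) :
    sphereEdgeThird n (d - 1) = ((sphereGraph n d).edgeSet.ncard : ℝ) / 3 ∧
    (2 : ℝ) ^ n / (hammingVolume n (d - 1) : ℝ) *
        ((Real.logb 2 (hammingVolume n (d - 1) : ℝ) -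
          Real.logb 2 (Real.sqrt (sphereEdgeThird n (d - 1)))) / 10)
      ≤ (A₂ n d : ℝ) := by
  refine ⟨gilbertGraph.sphereEdgeThird_eq_ncard_edgeSet_div_three, ?_⟩
  set t : ℕ := (sphereGraph n d).edgeSet.ncard with ht
  have hbound := HardCore.card_div_mul_logb_le_indepNum (G := gilbertGraph n d) (s := max t 1)
    (fun v => Nat.le_sub_one_of_lt (gilbertGraph.degree_add_one v).le) (le_max_right _ _)
    fun v => by
      rw [gilbertGraph.ncard_edgeSet_induce_neighborSet]
      exact le_max_left _ _
  have hvol : ((hammingVolume n (d - 1) - 1 : ℕ) : ℝ) + 1 = hammingVolume n (d - 1) := by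
    rw [← gilbertGraph.degree_add_one 0, add_tsub_cancel_right, Nat.cast_succ]
  have hlog : logb 2 √((max t 1 : ℝ) / 3) ≤ logb 2 √(sphereEdgeThird n (d - 1)) := by
    rw [gilbertGraph.sphereEdgeThird_eq_ncard_edgeSet_div_three, ← ht]
    rcases Nat.eq_zero_or_pos t with h_zero | h_pos
    · -- The right side is `logb 2 √0`, which is `0` as the informal statement prescribes.
      have hsqrt : √(1 / 3) ≤ 1 := sqrt_le_one.2 (by norm_num)
      simpa [h_zero] using logb_nonpos one_lt_two (sqrt_nonneg _) hsqrt
    · rw [max_eq_left (mod_cast h_pos)]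
  rw [hvol, gilbertGraph.indepNum_eq_A₂, Fintype.card_fun, ZMod.card, Fintype.card_fin] at hbound
  push_cast at hbound
  exact (mul_le_mul_of_nonneg_left (by linarith) (by positivity)).trans hbound
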